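/- Let $G$ be a second countable, locally Hausdorff, locally compact topological groupoid with unit space $G^{(0)}$, range and source maps $r,s$, and let $c:G\to Q$ be a continuous homomorphism into a locally compact Hausdorff group $Q$ with identity $e$. (No Haar system on $G$ and no amenability of $c^{-1}(e)$ is needed.) Let $$G(c)=\{(a,\gamma,b)\in Q\times G\times Q : b=a\,c(\gamma)\}$$ be the skew-product groupoid, with unit space $G^{(0)}\times Q$, $r(a,\gamma,b)=(r(\gamma),a)$, $s(a,\gamma,b)=(s(\gamma),b)$, $(a,\eta,b)(b,\gamma,d)=(a,\eta\gamma,d)$ and $(a,\gamma,b)^{-1}=(b,\gamma^{-1},a)$. Put $\tilde s(\gamma)=(s(\gamma),c(\gamma))$ and $Y=\tilde s(G)\subset G^{(0)}\times Q$, and let $G(c)|_Y$ be the reduction of $G(c)$ to $Y$, i.e. the set of arrows with range and source in $Y$. Let $c^{-1}(e)$ be the kernel of $c$, a groupoid with unit space $G^{(0)}$. Here all Borel spaces are required to be analytic. A left Borel $\mathcal G$-space $X$, with moment map $r_X$, is *proper* if there is a Borel family $(m^x)_{x\in X}$ of probability measures on $X*\mathcal G=\{(x,\gamma):r_X(x)=r(\gamma)\}$,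 with $m^x$ supported in $\{x\}\times r^{-1}(r_X(x))$, that is invariant under the diagonal action; a right action is proper if the corresponding left action $\gamma\cdot x=x\cdot\gamma^{-1}$ is. For Borel groupoids $\mathcal G,\mathcal H$, a *$(\mathcal G,\mathcal H)$-Borel equivalence* is a Borel space $Z$ that is a free and proper left Borel $\mathcal G$-space and a free and proper right Borel $\mathcal H$-space, with commuting actions, such that the left moment map induces a Borel isomorphism of $Z/\mathcal H$ onto $\mathcal G^{(0)}$ and the right moment map induces a Borel isomorphism of $\mathcal G\backslash Z$ onto $\mathcal H^{(0)}$ (quotient Borel structures). $\mathcal G$ and $\mathcal H$ are *Borel equivalent* if such a $Z$ exists. Then $G(c)|_Y$ and $c^{-1}(e)$ are Borel groupoids, and they are Borel equivalent. More precisely, $G$ is a $(c^{-1}(e),\,G(c)|_Y)$-Borel equivalence, where $c^{-1}(e)$ acts on the left of $G$ by multiplication, with moment map $r$, and $G(c)|_Y$ acts on the right of $G$ with moment map $\tilde s$ by $$\eta\cdot(c(\eta),\gamma,c(\eta\gamma))=\eta\gamma .$$ -/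

import Mathlib

open MeasureTheory Set
open scoped ENNReal

universe u

namespace BorelGpd

/-! ## Groupoids -/

/-- A groupoid with set of arrows `G` and unit space `U`: range `r`, source `s`, units, inversion,
and a product `g h` defined exactly for the composable pairs, those with `s g = r h`. -/
structure AlgGroupoid (G : Type*) (U : Type*) where
  r : G → U
  s : G → U
  unit : U → G
  inv : G → G
  mul : ∀ g h : G, s g = r h → G
  r_unit : ∀ u, r (unit u) = u
  s_unit : ∀ u, s (unit u) = u
  r_inv : ∀ g, r (inv g) = s g
  s_inv : ∀ g, s (inv g) = r g
  r_mul : ∀ g h e, r (mul g h e) = r g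
  s_mul : ∀ g h e, s (mul g h e) = s h
  unit_mul : ∀ g, mul (unit (r g)) g (s_unit _) = g
  mul_unit : ∀ g, mul g (unit (s g)) (r_unit _).symm = g
  inv_mul : ∀ g, mul (inv g) g (s_inv g) = unit (s g)
  mul_inv : ∀ g, mul g (inv g) (r_inv g).symm = unit (r g)
  mul_assoc : ∀ g h k (e₁ : s g = r h) (e₂ : s h = r k),
    mul (mul g h e₁) k ((s_mul g h e₁).trans e₂) = mul g (mul h k e₂) (e₁.trans (r_mul h k e₂).symm)

namespace AlgGroupoid

variable {G U : Type*} (𝒢 : AlgGroupoid G U)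

theorem mul_congr {g g' h h' : G} (hg : g = g') (hh : h = h') (e : 𝒢.s g = 𝒢.r h) :
    𝒢.mul g h e = 𝒢.mul g' h' (hg ▸ hh ▸ e) := by
  subst hg hh; rfl

theorem unit_mul' (u : U) (g : G) (e : 𝒢.s (𝒢.unit u) = 𝒢.r g) : 𝒢.mul (𝒢.unit u) g e = g := by
  have h : u = 𝒢.r g := (𝒢.s_unit u).symm.trans e
  subst h; exact 𝒢.unit_mul g

theorem mul_unit' (u : U) (g : G) (e : 𝒢.s g = 𝒢.r (𝒢.unit u)) : 𝒢.mul g (𝒢.unit u) e = g := by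
  have h : u = 𝒢.s g := (𝒢.r_unit u).symm.trans e.symm
  subst h; exact 𝒢.mul_unit g

theorem eq_inv_of_mul_eq_unit {g h : G} (e : 𝒢.s g = 𝒢.r h) (u : U)
    (H : 𝒢.mul g h e = 𝒢.unit u) : g = 𝒢.inv h := by
  have h1 := 𝒢.mul_assoc g h (𝒢.inv h) e (𝒢.r_inv h).symm
  rw [𝒢.mul_congr H rfl, 𝒢.unit_mul', 𝒢.mul_congr rfl (𝒢.mul_inv h), 𝒢.mul_unit'] at h1
  exact h1.symm

theorem inv_unit (u : U) : 𝒢.inv (𝒢.unit u) = 𝒢.unit u :=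
  (𝒢.eq_inv_of_mul_eq_unit ((𝒢.s_unit u).trans (𝒢.r_unit u).symm) u (𝒢.unit_mul' _ _ _)).symm

theorem inv_inv (g : G) : 𝒢.inv (𝒢.inv g) = g :=
  (𝒢.eq_inv_of_mul_eq_unit (𝒢.r_inv g).symm _ (𝒢.mul_inv g)).symm

theorem inv_mul_rev (g h : G) (e : 𝒢.s g = 𝒢.r h) :
    𝒢.inv (𝒢.mul g h e) =
      𝒢.mul (𝒢.inv h) (𝒢.inv g) ((𝒢.s_inv h).trans (e.symm.trans (𝒢.r_inv g).symm)) := by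
  have e0 : 𝒢.s (𝒢.inv h) = 𝒢.r (𝒢.inv g) := (𝒢.s_inv h).trans (e.symm.trans (𝒢.r_inv g).symm)
  have e1 : 𝒢.s (𝒢.inv g) = 𝒢.r (𝒢.mul g h e) := (𝒢.s_inv g).trans (𝒢.r_mul g h e).symm
  symm
  refine 𝒢.eq_inv_of_mul_eq_unit ((𝒢.s_mul _ _ e0).trans e1) (𝒢.s h) ?_
  rw [𝒢.mul_assoc (𝒢.inv h) (𝒢.inv g) (𝒢.mul g h e) e0 e1]
  have h2 : 𝒢.mul (𝒢.inv g) (𝒢.mul g h e) e1 = h := by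
    rw [← 𝒢.mul_assoc (𝒢.inv g) g h (𝒢.s_inv g) e, 𝒢.mul_congr (𝒢.inv_mul g) rfl, 𝒢.unit_mul']
  rw [𝒢.mul_congr rfl h2]
  exact 𝒢.inv_mul h

/-- The composable pairs `G⁽²⁾`. -/
abbrev Composable : Type _ := {p : G × G // 𝒢.s p.1 = 𝒢.r p.2}

/-- Topological groupoid: all structure maps are continuous. As `r ∘ unit = id`, the map `unit` is
then a homeomorphism of `U` onto the set of units with its relative topology. -/
structure IsTopological [TopologicalSpace G] [TopologicalSpace U] : Prop where
  continuous_r : Continuous 𝒢.r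
  continuous_s : Continuous 𝒢.s
  continuous_unit : Continuous 𝒢.unit
  continuous_inv : Continuous 𝒢.inv
  continuous_mul : Continuous fun p : 𝒢.Composable => 𝒢.mul p.1.1 p.1.2 p.2

/-- The reduction `𝒢|_Y` to a set `Y` of units: the arrows with range and source in `Y`. -/
def reduction (Y : Set U) : AlgGroupoid {g : G // 𝒢.r g ∈ Y ∧ 𝒢.s g ∈ Y} Y where
  r g := ⟨𝒢.r g.1, g.2.1⟩
  s g := ⟨𝒢.s g.1, g.2.2⟩
  unit u := ⟨𝒢.unit u.1, by rw [𝒢.r_unit, 𝒢.s_unit]; exact ⟨u.2, u.2⟩⟩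
  inv g := ⟨𝒢.inv g.1, by rw [𝒢.r_inv, 𝒢.s_inv]; exact ⟨g.2.2, g.2.1⟩⟩
  mul g h e := ⟨𝒢.mul g.1 h.1 (congrArg Subtype.val e), by
    rw [𝒢.r_mul, 𝒢.s_mul]; exact ⟨g.2.1, h.2.2⟩⟩
  r_unit u := Subtype.ext (𝒢.r_unit _)
  s_unit u := Subtype.ext (𝒢.s_unit _)
  r_inv g := Subtype.ext (𝒢.r_inv _)
  s_inv g := Subtype.ext (𝒢.s_inv _)
  r_mul g h e := Subtype.ext (𝒢.r_mul _ _ _)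
  s_mul g h e := Subtype.ext (𝒢.s_mul _ _ _)
  unit_mul g := Subtype.ext (𝒢.unit_mul _)
  mul_unit g := Subtype.ext (𝒢.mul_unit _)
  inv_mul g := Subtype.ext (𝒢.inv_mul _)
  mul_inv g := Subtype.ext (𝒢.mul_inv _)
  mul_assoc g h k e₁ e₂ := Subtype.ext (𝒢.mul_assoc _ _ _ _ _)

end AlgGroupoid

/-- Every point has an open neighbourhood that is Hausdorff in the relative topology. -/
def LocallyHausdorff (X : Type*) [TopologicalSpace X] : Prop :=
  ∀ x : X, ∃ V : Set X, IsOpen V ∧ x ∈ V ∧ T2Space V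

/-! ## Borel groupoids and Borel actions -/

/-- Analytic Borel spaces: those isomorphic to an analytic subset of a Polish space with its
relative Borel structure. -/
def IsAnalyticBorel (X : Type*) [mX : MeasurableSpace X] : Prop :=
  ∃ (P : Type) (_ : TopologicalSpace P) (_ : PolishSpace P) (f : X → P),
    Function.Injective f ∧ AnalyticSet (range f) ∧ mX = (borel P).comap f

/-- Borel groupoids. The composable pairs carry the relative product Borel structure, and all
Borel spaces are analytic. -/
structure IsBorelGroupoid {G U : Type*} [MeasurableSpace G] [MeasurableSpace U]
    (𝒢 : AlgGroupoid G U) : Prop where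
  analytic : IsAnalyticBorel G
  analytic_unit : IsAnalyticBorel U
  measurable_r : Measurable 𝒢.r
  measurable_s : Measurable 𝒢.s
  measurable_unit : Measurable 𝒢.unit
  measurable_inv : Measurable 𝒢.inv
  measurable_mul : Measurable fun p : 𝒢.Composable => 𝒢.mul p.1.1 p.1.2 p.2

/-- A left action of a groupoid on `X`, with moment map `moment` (often written `r_X`):
`g • x` is defined when `s g = moment x`. -/
structure LeftAction {G U : Type*} (𝒢 : AlgGroupoid G U) (X : Type*) where
  moment : X → U
  act : ∀ (g : G) (x : X), 𝒢.s g = moment x → X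
  moment_act : ∀ g x e, moment (act g x e) = 𝒢.r g
  unit_act : ∀ x, act (𝒢.unit (moment x)) x (𝒢.s_unit _) = x
  mul_act : ∀ g h x (e₁ : 𝒢.s g = 𝒢.r h) (e₂ : 𝒢.s h = moment x),
    act (𝒢.mul g h e₁) x ((𝒢.s_mul g h e₁).trans e₂) =
      act g (act h x e₂) (e₁.trans (moment_act h x e₂).symm)

/-- A right action of a groupoid on `X`, with moment map `moment` (often written `s_X`):
`x • g` is defined when `moment x = r g`. -/
structure RightAction {G U : Type*} (𝒢 : AlgGroupoid G U) (X : Type*) where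
  moment : X → U
  act : ∀ (x : X) (g : G), moment x = 𝒢.r g → X
  moment_act : ∀ x g e, moment (act x g e) = 𝒢.s g
  act_unit : ∀ x, act x (𝒢.unit (moment x)) (𝒢.r_unit _).symm = x
  act_mul : ∀ x g h (e₁ : moment x = 𝒢.r g) (e₂ : 𝒢.s g = 𝒢.r h),
    act x (𝒢.mul g h e₂) (e₁.trans (𝒢.r_mul g h e₂).symm) =
      act (act x g e₁) h ((moment_act x g e₁).trans e₂)

/-- The left action `g • x = x • g⁻¹` that corresponds to a right action. -/
def RightAction.toLeft {G U : Type*} {𝒢 : AlgGroupoid G U} {X : Type*} (R : RightAction 𝒢 X) :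
    LeftAction 𝒢 X where
  moment := R.moment
  act g x e := R.act x (𝒢.inv g) (e.symm.trans (𝒢.r_inv g).symm)
  moment_act g x e := (R.moment_act _ _ _).trans (𝒢.s_inv g)
  unit_act x := by
    have h : ∀ (g : G) (_ : g = 𝒢.unit (R.moment x)) (e : R.moment x = 𝒢.r g),
        R.act x g e = x := by
      intro g hg e; subst hg; exact R.act_unit x
    exact h _ (𝒢.inv_unit _) _
  mul_act g h x e₁ e₂ := by
    have h' : ∀ (k : G) (_ : k = 𝒢.mul (𝒢.inv h) (𝒢.inv g)
        ((𝒢.s_inv h).trans (e₁.symm.trans (𝒢.r_inv g).symm))) (e : R.moment x = 𝒢.r k),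
        R.act x k e = R.act (R.act x (𝒢.inv h) (e₂.symm.trans (𝒢.r_inv h).symm)) (𝒢.inv g)
          ((R.moment_act _ _ _).trans ((𝒢.s_inv h).trans (e₁.symm.trans (𝒢.r_inv g).symm))) := by
      intro k hk e; subst hk; exact R.act_mul x _ _ _ _
    exact h' _ (𝒢.inv_mul_rev g h e₁) _

/-- `m` is a Borel `π`-system of probability measures: `m y` is a probability measure supported
in the fibre `π⁻¹(y)`, and `y ↦ ∫ f dm^y` is Borel for every non-negative Borel `f`. -/
structure IsProbSystem {X Y : Type*} [MeasurableSpace X] [MeasurableSpace Y] (π : X → Y)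
    (m : Y → Measure X) : Prop where
  isProb : ∀ y, IsProbabilityMeasure (m y)
  support : ∀ y, m y (π ⁻¹' {y})ᶜ = 0
  measurable_lintegral : ∀ f : X → ℝ≥0∞, Measurable f → Measurable fun y => ∫⁻ x, f x ∂(m y)

namespace LeftAction

variable {G U X Y : Type*} {𝒢 : AlgGroupoid G U}

/-- The orbit equivalence relation. -/
def orbitRel (A : LeftAction 𝒢 X) : Setoid X where
  r x y := ∃ (g : G) (e : 𝒢.s g = A.moment x), A.act g x e = y
  iseqv := by
    refine ⟨fun x => ⟨_, _, A.unit_act x⟩, ?_, ?_⟩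
    · rintro x y ⟨g, e, rfl⟩
      refine ⟨𝒢.inv g, (𝒢.s_inv g).trans (A.moment_act g x e).symm, ?_⟩
      rw [← A.mul_act (𝒢.inv g) g x (𝒢.s_inv g) e]
      have h : ∀ (k : G) (_ : k = 𝒢.unit (A.moment x)) (e : 𝒢.s k = A.moment x),
          A.act k x e = x := by
        intro k hk e; subst hk; exact A.unit_act x
      exact h _ ((𝒢.inv_mul g).trans (congrArg 𝒢.unit e)) _
    · rintro x y z ⟨g, e, rfl⟩ ⟨h, e', rfl⟩
      exact ⟨_, _, A.mul_act h g x (e'.trans (A.moment_act g x e)) e⟩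

/-- The action is free: only units fix a point. -/
def IsFree (A : LeftAction 𝒢 X) : Prop :=
  ∀ (g : G) (x : X) (e : 𝒢.s g = A.moment x), A.act g x e = x → g = 𝒢.unit (A.moment x)

/-- `X` is a Borel `𝒢`-space: an analytic Borel space with Borel moment map and Borel action. -/
structure IsBorel [MeasurableSpace G] [MeasurableSpace U] [MeasurableSpace X]
    (A : LeftAction 𝒢 X) : Prop where
  analytic : IsAnalyticBorel X
  measurable_moment : Measurable A.moment
  measurable_act :
    Measurable fun p : {p : G × X // 𝒢.s p.1 = A.moment p.2} => A.act p.1.1 p.1.2 p.2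

/-- `π : X → Y` is a `𝒢`-map: it intertwines the moment maps and the actions. -/
structure IsEquivariant (A : LeftAction 𝒢 X) (B : LeftAction 𝒢 Y) (π : X → Y) : Prop where
  moment_map : ∀ x, B.moment (π x) = A.moment x
  map_act : ∀ g x (e : 𝒢.s g = A.moment x),
    π (A.act g x e) = B.act g (π x) (e.trans (moment_map x).symm)

/-- `m` is invariant, `g • m^y = m^{g • y}` whenever `g • y` is defined, where
`(g • m^y)(E) = m^y(g⁻¹ • E)`; here `g⁻¹ • E` is the set of `x` for which `g • x` is defined and
belongs to `E`. -/
def IsInvariantSystem [MeasurableSpace X] (A : LeftAction 𝒢 X) (B : LeftAction 𝒢 Y)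
    (m : Y → Measure X) : Prop :=
  ∀ (g : G) (y : Y) (e : 𝒢.s g = B.moment y) (E : Set X), MeasurableSet E →
    m (B.act g y e) E = m y {x | ∃ e' : 𝒢.s g = A.moment x, A.act g x e' ∈ E}

/-- `π : X → Y` is `𝒢`-properly amenable: a surjective Borel `𝒢`-map with an invariant Borel
`π`-system of probability measures. -/
structure IsProperlyAmenable [MeasurableSpace X] [MeasurableSpace Y] (A : LeftAction 𝒢 X)
    (B : LeftAction 𝒢 Y) (π : X → Y) : Prop where
  surjective : Function.Surjective π
  measurable : Measurable π
  equivariant : IsEquivariant A B π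
  exists_system : ∃ m : Y → Measure X, IsProbSystem π m ∧ IsInvariantSystem A B m

/-- The fibred product `X * 𝒢` of pairs `(x, g)` whose moments agree, `r_X(x) = r(g)`. It carries
the relative product Borel structure. -/
abbrev Fibred (A : LeftAction 𝒢 X) : Type _ := {p : X × G // A.moment p.1 = 𝒢.r p.2}

/-- The diagonal action `g • (x, h) = (g • x, g h)` on `X * 𝒢`. -/
def diag (A : LeftAction 𝒢 X) : LeftAction 𝒢 A.Fibred where
  moment p := A.moment p.1.1
  act g p e := ⟨(A.act g p.1.1 e, 𝒢.mul g p.1.2 (e.trans p.2)), by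
    rw [A.moment_act, 𝒢.r_mul]⟩
  moment_act g p e := A.moment_act g p.1.1 e
  unit_act p := Subtype.ext (Prod.ext (A.unit_act _) (𝒢.unit_mul' _ _ _))
  mul_act g h p e₁ e₂ := Subtype.ext (Prod.ext (A.mul_act _ _ _ _ _) (𝒢.mul_assoc _ _ _ _ _))

/-- `X` is a proper `𝒢`-space: the projection `X * 𝒢 → X` is `𝒢`-properly amenable. -/
def IsProper [MeasurableSpace G] [MeasurableSpace X] (A : LeftAction 𝒢 X) : Prop :=
  IsProperlyAmenable A.diag A fun p : A.Fibred => p.1.1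

end LeftAction

namespace RightAction

variable {G U X : Type*} {𝒢 : AlgGroupoid G U}

/-- The action is free: only units fix a point. -/
def IsFree (R : RightAction 𝒢 X) : Prop :=
  ∀ (x : X) (g : G) (e : R.moment x = 𝒢.r g), R.act x g e = x → g = 𝒢.unit (R.moment x)

/-- `X` is a right Borel `𝒢`-space. -/
structure IsBorel [MeasurableSpace G] [MeasurableSpace U] [MeasurableSpace X]
    (R : RightAction 𝒢 X) : Prop where
  analytic : IsAnalyticBorel X
  measurable_moment : Measurable R.moment
  measurable_act :
    Measurable fun p : {p : X × G // R.moment p.1 = 𝒢.r p.2} => R.act p.1.1 p.1.2 p.2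

/-- `X` is a proper right `𝒢`-space: proper for the corresponding left action. -/
def IsProper [MeasurableSpace G] [MeasurableSpace X] (R : RightAction 𝒢 X) : Prop :=
  R.toLeft.IsProper

/-- The orbit equivalence relation; it is that of the corresponding left action. -/
def orbitRel (R : RightAction 𝒢 X) : Setoid X := R.toLeft.orbitRel

end RightAction

/-- With these two actions `Z` is a `(𝒢, ℋ)`-Borel equivalence. Orbit spaces carry the quotient
Borel structure. -/
structure IsBorelEquivalence {G U H V Z : Type*} [MeasurableSpace G] [MeasurableSpace U]
    [MeasurableSpace H] [MeasurableSpace V] [MeasurableSpace Z]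
    {𝒢 : AlgGroupoid G U} {ℋ : AlgGroupoid H V}
    (L : LeftAction 𝒢 Z) (R : RightAction ℋ Z) : Prop where
  left_borel : L.IsBorel
  left_free : L.IsFree
  left_proper : L.IsProper
  right_borel : R.IsBorel
  right_free : R.IsFree
  right_proper : R.IsProper
  /-- The actions commute: each moment map is invariant under the other action, and
  `(g • z) • h = g • (z • h)`. -/
  left_moment_act : ∀ z h e, L.moment (R.act z h e) = L.moment z
  right_moment_act : ∀ g z e, R.moment (L.act g z e) = R.moment z
  comm : ∀ g z h (e₁ : 𝒢.s g = L.moment z) (e₂ : R.moment z = ℋ.r h),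
    R.act (L.act g z e₁) h ((right_moment_act g z e₁).trans e₂) =
      L.act g (R.act z h e₂) (e₁.trans (left_moment_act z h e₂).symm)
  /-- The left moment map induces a Borel isomorphism of `Z/ℋ` onto the unit space of `𝒢`. -/
  quotient_right : ∃ φ : Quotient R.orbitRel ≃ᵐ U, ∀ z : Z, φ (Quotient.mk _ z) = L.moment z
  /-- The right moment map induces a Borel isomorphism of `𝒢\Z` onto the unit space of `ℋ`. -/
  quotient_left : ∃ φ : Quotient L.orbitRel ≃ᵐ V, ∀ z : Z, φ (Quotient.mk _ z) = R.moment z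

/-- Two Borel groupoids are Borel equivalent if there is a Borel equivalence between them. -/
def BorelEquivalent.{w, u₁, u₂, u₃, u₄} {G : Type u₁} {U : Type u₂} {H : Type u₃} {V : Type u₄}
    [MeasurableSpace G] [MeasurableSpace U] [MeasurableSpace H] [MeasurableSpace V]
    (𝒢 : AlgGroupoid G U) (ℋ : AlgGroupoid H V) : Prop :=
  ∃ (Z : Type w) (_ : MeasurableSpace Z) (L : LeftAction 𝒢 Z) (R : RightAction ℋ Z),
    IsBorelEquivalence L R

/-! ## Cocycles, their kernels and skew products -/

/-- A cocycle: a homomorphism of the groupoid `𝒢` into the group `Q`. -/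
structure Cocycle {G U : Type*} (𝒢 : AlgGroupoid G U) (Q : Type*) [Group Q] where
  toFun : G → Q
  map_mul' : ∀ g h (e : 𝒢.s g = 𝒢.r h), toFun (𝒢.mul g h e) = toFun g * toFun h

namespace Cocycle

variable {G U : Type*} {𝒢 : AlgGroupoid G U} {Q : Type*} [Group Q] (c : Cocycle 𝒢 Q)

instance : CoeFun (Cocycle 𝒢 Q) fun _ => G → Q := ⟨toFun⟩

theorem map_mul (g h : G) (e : 𝒢.s g = 𝒢.r h) : c (𝒢.mul g h e) = c g * c h := c.map_mul' g h e

theorem map_unit (u : U) : c (𝒢.unit u) = 1 := by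
  have h := c.map_mul (𝒢.unit u) (𝒢.unit u) ((𝒢.s_unit u).trans (𝒢.r_unit u).symm)
  rw [𝒢.unit_mul'] at h
  exact left_eq_mul.mp h

theorem map_inv (g : G) : c (𝒢.inv g) = (c g)⁻¹ := by
  have h := c.map_mul (𝒢.inv g) g (𝒢.s_inv g)
  rw [𝒢.inv_mul, c.map_unit] at h
  exact eq_inv_of_mul_eq_one_left h.symm

/-- The kernel `c⁻¹(e)`, a subgroupoid with the same unit space. -/
def ker : AlgGroupoid {g : G // c g = 1} U where
  r g := 𝒢.r g.1
  s g := 𝒢.s g.1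
  unit u := ⟨𝒢.unit u, c.map_unit u⟩
  inv g := ⟨𝒢.inv g.1, by rw [c.map_inv, g.2, inv_one]⟩
  mul g h e := ⟨𝒢.mul g.1 h.1 e, by rw [c.map_mul, g.2, h.2, one_mul]⟩
  r_unit := 𝒢.r_unit
  s_unit := 𝒢.s_unit
  r_inv g := 𝒢.r_inv g.1
  s_inv g := 𝒢.s_inv g.1
  r_mul g h e := 𝒢.r_mul _ _ e
  s_mul g h e := 𝒢.s_mul _ _ e
  unit_mul g := Subtype.ext (𝒢.unit_mul _)
  mul_unit g := Subtype.ext (𝒢.mul_unit _)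
  inv_mul g := Subtype.ext (𝒢.inv_mul _)
  mul_inv g := Subtype.ext (𝒢.mul_inv _)
  mul_assoc g h k e₁ e₂ := Subtype.ext (𝒢.mul_assoc _ _ _ _ _)

/-- The arrows `(a, γ, b)`, `b = a c(γ)`, of the skew product. -/
abbrev SkewArrow : Type _ := {p : Q × G × Q // p.2.2 = p.1 * c p.2.1}

/-- The skew product `𝒢(c)`, with unit space `U × Q`: `r(a, γ, b) = (r(γ), a)`,
`s(a, γ, b) = (s(γ), b)`, `(a, η, b)(b, γ, d) = (a, ηγ, d)` and `(a, γ, b)⁻¹ = (b, γ⁻¹, a)`. -/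
def skew : AlgGroupoid c.SkewArrow (U × Q) where
  r p := (𝒢.r p.1.2.1, p.1.1)
  s p := (𝒢.s p.1.2.1, p.1.2.2)
  unit v := ⟨(v.2, 𝒢.unit v.1, v.2), by simp [c.map_unit]⟩
  inv p := ⟨(p.1.2.2, 𝒢.inv p.1.2.1, p.1.1), by simp [c.map_inv, p.2]⟩
  mul p q e := ⟨(p.1.1, 𝒢.mul p.1.2.1 q.1.2.1 (congrArg Prod.fst e), q.1.2.2), by
    have h : p.1.2.2 = q.1.1 := congrArg Prod.snd e
    simp only [c.map_mul]
    rw [q.2, ← h, p.2, _root_.mul_assoc]⟩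
  r_unit v := Prod.ext (𝒢.r_unit _) rfl
  s_unit v := Prod.ext (𝒢.s_unit _) rfl
  r_inv p := Prod.ext (𝒢.r_inv _) rfl
  s_inv p := Prod.ext (𝒢.s_inv _) rfl
  r_mul p q e := Prod.ext (𝒢.r_mul _ _ _) rfl
  s_mul p q e := Prod.ext (𝒢.s_mul _ _ _) rfl
  unit_mul p := Subtype.ext (Prod.ext rfl (Prod.ext (𝒢.unit_mul _) rfl))
  mul_unit p := Subtype.ext (Prod.ext rfl (Prod.ext (𝒢.mul_unit _) rfl))
  inv_mul p := Subtype.ext (Prod.ext rfl (Prod.ext (𝒢.inv_mul _) rfl))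
  mul_inv p := Subtype.ext (Prod.ext rfl (Prod.ext (𝒢.mul_inv _) rfl))
  mul_assoc p q t e₁ e₂ := Subtype.ext (Prod.ext rfl (Prod.ext (𝒢.mul_assoc _ _ _ _ _) rfl))

/-- The map `γ ↦ (s(γ), c(γ))`. -/
def sTilde (γ : G) : U × Q := (𝒢.s γ, c γ)

/-- The image `Y` of `γ ↦ (s(γ), c(γ))`, a set of units of the skew product. -/
def Y : Set (U × Q) := range c.sTilde

/-- The reduction `𝒢(c)|_Y`. -/
abbrev skewY : AlgGroupoid {p : c.SkewArrow // c.skew.r p ∈ c.Y ∧ c.skew.s p ∈ c.Y} c.Y :=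
  c.skew.reduction c.Y

/-- The kernel acts on the left of `G` by multiplication, with moment map `r`. -/
def kerAction : LeftAction c.ker G where
  moment := 𝒢.r
  act n γ e := 𝒢.mul n.1 γ e
  moment_act _ _ e := 𝒢.r_mul _ _ e
  unit_act γ := 𝒢.unit_mul γ
  mul_act _ _ _ e₁ e₂ := 𝒢.mul_assoc _ _ _ e₁ e₂

/-- `𝒢(c)|_Y` acts on the right of `G` with moment map `γ ↦ (s(γ), c(γ))` and
`η • (c(η), γ, c(ηγ)) = ηγ`. -/
def skewYAction : RightAction c.skewY G where
  moment η := ⟨c.sTilde η, mem_range_self η⟩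
  act η p e := 𝒢.mul η p.1.1.2.1 (congrArg (fun y : c.Y => y.1.1) e)
  moment_act η p e := by
    have h : c η = p.1.1.1 := congrArg (fun y : c.Y => y.1.2) e
    exact Subtype.ext (Prod.ext (𝒢.s_mul _ _ _)
      ((c.map_mul _ _ _).trans ((congrArg (· * c p.1.1.2.1) h).trans p.1.2.symm)))
  act_unit η := 𝒢.mul_unit η
  act_mul η p q e₁ e₂ := (𝒢.mul_assoc _ _ _ _ _).symm

end Cocycle

end BorelGpd

open BorelGpd

open MeasurableSpace Topology Function

/-! The algebra is short. Two arrows lie in one orbit of the kernel exactly when `c.sTilde` agrees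
on them, through `y x⁻¹`; they lie in one orbit of the reduced skew product exactly when their
ranges agree, through `x⁻¹ y`. Both actions are free by cancellation.

The Borel part reduces to a Borel section `σ` of `c.sTilde : G → Y`. A Borel map with a Borel
section whose fibres are the orbits induces a Borel isomorphism of the orbit space; for the range
map the units give the section. Properness needs no Haar system: an equivariant Borel map `F` into
the acting groupoid yields the invariant system of Dirac masses at `(x, F x)`. For the kernel `F γ =
γ (σ (s γ, c γ))⁻¹`, and for the skew product `F η = (c η, η⁻¹, 1)`.

The difficulty is that units and arrows are only locally Hausdorff and that `Q` need not be second
countable. `exists_cantorSet_cover` writes `G` as a countable union of continuous images of the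
Cantor set, each with its sources in one Hausdorff open set. On each piece the fibres of `c.sTilde`
are closed and the images of closed sets are Borel for the product structure
(`measurableSet_image_pair`), so taking least points of fibres gives `σ`. Analyticity follows from
`isAnalyticBorel_of_surjective`; on the `Q` side, countable separation of `range c` suffices. -/

/-! ### Countably separated and analytic Borel spaces -/

/-- A measurable space with a measurable injection into a countably separated one is countably
separated. -/
theorem countablySeparated_of_injective {X Y : Type*} [MeasurableSpace X] [MeasurableSpace Y]
    [CountablySeparated Y] {f : X → Y} (hf : Measurable f) (hinj : Injective f) :
    CountablySeparated X := by
  obtain ⟨S, hc, hm, hs⟩ := exists_countable_separating Y MeasurableSet univ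
  refine ⟨⟨preimage f '' S, hc.image _, ?_, fun x _ y _ h => hinj ?_⟩⟩
  · rintro _ ⟨s, hs', rfl⟩
    exact hf (hm s hs')
  · exact hs _ trivial _ trivial fun s hs' => h _ (mem_image_of_mem _ hs')

theorem countablySeparated_prod {X Y : Type*} [MeasurableSpace X] [MeasurableSpace Y]
    [CountablySeparated X] [CountablySeparated Y] : CountablySeparated (X × Y) := by
  obtain ⟨f, hf, hfi⟩ := measurable_injection_nat_bool_of_countablySeparated X
  obtain ⟨g, hg, hgi⟩ := measurable_injection_nat_bool_of_countablySeparated Y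
  exact countablySeparated_of_injective (hf.prodMap hg) (hfi.prodMap hgi)

theorem measurableEq_of_countablySeparated (X : Type*) [MeasurableSpace X]
    [CountablySeparated X] : MeasurableEq X := by
  obtain ⟨f, hf, hfi⟩ := measurable_injection_nat_bool_of_countablySeparated X
  refine ⟨?_⟩
  convert measurableSet_eq_fun (hf.comp measurable_fst) (hf.comp measurable_snd) using 1
  ext p
  exact hfi.eq_iff.symm

/-- A countably separated measurable image of a standard Borel space is an analytic Borel space. -/
theorem isAnalyticBorel_of_surjective {W X : Type*} [MeasurableSpace W] [StandardBorelSpace W]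
    [mX : MeasurableSpace X] [CountablySeparated X] {f : W → X} (hf : Measurable f)
    (hsurj : Surjective f) : IsAnalyticBorel X := by
  -- A Borel surjection from a standard Borel space onto a countably separated one forces the target
  -- to carry the quotient structure. Applied both to `mX` and to a countably generated separating
  -- `m' ≤ mX`, this gives `m' = mX`, so `X` embeds in the Cantor space.
  have h1 := hf.map_measurableSpace_eq hsurj
  obtain ⟨m', hg, hs, hle⟩ := exists_countablyGenerated_le_of_countablySeparated X
  have hcs : @CountablySeparated X m' := @countablySeparated_of_separatesPoints X m' hg hs
  have h2 := @Measurable.map_measurableSpace_eq _ _ _ _ m' hcs f (hf.mono le_rfl hle) hsurj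
  have hm : m' = mX := h2.symm.trans h1
  subst hm
  obtain ⟨s, ⟨φ⟩⟩ := measurableEquiv_nat_bool_of_countablyGenerated X
  have hcoe : Measurable fun x : X => ((φ x : s) : ℕ → Bool) :=
    measurable_subtype_coe.comp φ.measurable
  have : PolishSpace (ℕ → Bool) := {}
  refine ⟨ℕ → Bool, inferInstance, inferInstance, fun x => φ x,
    Subtype.val_injective.comp φ.injective, ?_, ?_⟩
  · have h := MeasurableSet.univ.analyticSet_image (hcoe.comp hf)
    rwa [image_univ, hsurj.range_comp] at h
  · refine (φ.measurableEmbedding.comap_eq).symm.trans ?_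
    rw [← BorelSpace.measurable_eq (α := ℕ → Bool)]
    exact MeasurableSpace.comap_comp

namespace BorelGpd

/-! ### Borel images and Borel sections -/

/-- The images of closed sets under a pair of Borel maps on a compact Polish space with closed
kernels and countably separated Borel ranges are Borel for the product Borel structure. -/
theorem measurableSet_image_pair {K : Type*} [TopologicalSpace K] [CompactSpace K]
    [PolishSpace K] [MeasurableSpace K] [BorelSpace K]
    {U Q : Type*} [MeasurableSpace U] [MeasurableSpace Q] {α : K → U} {β : K → Q}
    (hα : Measurable α) (hβ : Measurable β) (hA : MeasurableSet (range α))
    (hB : MeasurableSet (range β)) [CountablySeparated (range α)] [CountablySeparated (range β)]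
    (hα' : IsClosed {p : K × K | α p.1 = α p.2}) (hβ' : IsClosed {p : K × K | β p.1 = β p.2})
    {C : Set K} (hC : IsClosed C) : MeasurableSet ((fun w => (α w, β w)) '' C) := by
  have := countablySeparated_prod (X := range α) (Y := range β)
  let h : K × K → range α × range β := Prod.map (rangeFactorization α) (rangeFactorization β)
  have hh : Measurable h :=
    (hα.subtype_mk).prodMap (hβ.subtype_mk)
  have hsurj : Surjective h := rangeFactorization_surjective.prodMap rangeFactorization_surjective
  have hemb : MeasurableEmbedding
      (Prod.map Subtype.val Subtype.val : range α × range β → U × Q) :=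
    (MeasurableEmbedding.subtype_coe hA).prodMap (MeasurableEmbedding.subtype_coe hB)
  let F : Set (range α × range β) := {p | ∃ w ∈ C, α w = p.1 ∧ β w = p.2}
  have hF : MeasurableSet F := by
    -- Borel sets downstairs are those with Borel preimage in `K × K`. Here the preimage is the
    -- projection of a closed set along the compact factor `K`, hence closed.
    rw [← hh.measurableSet_preimage_iff_of_surjective hsurj]
    have hcl : IsClosed {p : K × K × K | p.1 ∈ C ∧ α p.1 = α p.2.1 ∧ β p.1 = β p.2.2} :=
      (hC.preimage continuous_fst).inter
        ((hα'.preimage (continuous_fst.prodMk continuous_snd.fst)).inter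
          (hβ'.preimage (continuous_fst.prodMk continuous_snd.snd)))
    convert (isClosedMap_snd_of_compactSpace _ hcl).measurableSet using 1
    ext p
    simp [F, h]
  convert hemb.measurableSet_image.2 hF using 1
  ext ⟨u, q⟩
  simp only [mem_image, F, Prod.exists, mem_ofPred_eq, Prod.mk.injEq, Prod.map_apply]
  constructor
  · rintro ⟨w, hw, rfl, rfl⟩
    exact ⟨⟨_, mem_range_self w⟩, ⟨_, mem_range_self w⟩, ⟨w, hw, rfl, rfl⟩, rfl, rfl⟩
  · rintro ⟨a, b, ⟨w, hw, h1, h2⟩, rfl, rfl⟩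
    exact ⟨w, hw, h1, h2⟩

/-- A map with least points in its fibres, with respect to a Borel injection into the reals, has a
Borel section if the images of the sublevel sets are Borel. -/
theorem exists_measurable_section_of_isLeast {W Y : Type*} [MeasurableSpace W]
    [StandardBorelSpace W] [MeasurableSpace Y] {h : W → Y} {e : W → ℝ} (he : Measurable e)
    (hinj : Injective e) (hleast : ∀ y, ∃ w, h w = y ∧ ∀ w', h w' = y → e w ≤ e w')
    (hmeas : ∀ a, MeasurableSet (h '' {w | e w ≤ a})) :
    ∃ σ : Y → W, Measurable σ ∧ ∀ y, h (σ y) = y := by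
  choose σ hσ hmin using hleast
  refine ⟨σ, ?_, hσ⟩
  rw [← (he.measurableEmbedding hinj).measurable_comp_iff]
  refine measurable_of_Iic fun a => ?_
  -- Since `σ y` minimises `e` on its fibre, `e (σ y) ≤ a` holds exactly when some point of the
  -- fibre satisfies this bound.
  convert hmeas a using 1
  ext y
  constructor
  · exact fun hy => ⟨σ y, hy, hσ y⟩
  · rintro ⟨w, hw, rfl⟩
    exact (hmin _ w rfl).trans hw

/-- A countable family of maps on the Cantor set with closed fibres and Borel images of closed sets
has a joint Borel section. -/
theorem exists_measurable_section_cantorSet {ι Y : Type*} [Countable ι] [MeasurableSpace Y]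
    {h : ι → cantorSet → Y} (hfib : ∀ i y, IsClosed {x | h i x = y})
    (himg : ∀ i C, IsClosed C → MeasurableSet (h i '' C)) (hsurj : ∀ y, ∃ i x, h i x = y)
    [MeasurableSpace ι] [DiscreteMeasurableSpace ι] :
    ∃ σ : Y → ι × cantorSet, Measurable σ ∧ ∀ y, h (σ y).1 (σ y).2 = y := by
  have : CompactSpace cantorSet := isCompact_iff_compactSpace.1 isCompact_cantorSet
  have : PolishSpace cantorSet := isClosed_cantorSet.polishSpace
  obtain ⟨n, hn⟩ := Countable.exists_injective_nat ι
  -- The factor 2 places the copies of the Cantor set in the disjoint intervals `[2n, 2n + 1]`, so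
  -- `e` is injective and orders pairs lexicographically.
  let e : ι × cantorSet → ℝ := fun p => 2 * n p.1 + p.2
  have hlt : ∀ i j (x y : cantorSet), n i < n j → e (i, x) < e (j, y) := by
    intro i j x y hij
    have h1 : (n i : ℝ) + 1 ≤ n j := by exact_mod_cast hij
    have h2 := (cantorSet_subset_unitInterval x.2).2
    have h3 := (cantorSet_subset_unitInterval y.2).1
    simp only [e]
    linarith
  have he : Measurable e := by
    refine Measurable.add ?_ (measurable_subtype_coe.comp measurable_snd)
    exact (Measurable.of_discrete (f := fun i => (2 : ℝ) * n i)).comp measurable_fst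
  have hinj : Injective e := by
    rintro ⟨i, x⟩ ⟨j, y⟩ hxy
    rcases lt_trichotomy (n i) (n j) with h1 | h1 | h1
    · exact absurd hxy (hlt _ _ _ _ h1).ne
    · obtain rfl := hn h1
      exact Prod.ext rfl (Subtype.ext (by simpa [e] using hxy))
    · exact absurd hxy (hlt _ _ _ _ h1).ne'
  refine exists_measurable_section_of_isLeast (h := fun p => h p.1 p.2) he hinj
    (fun y => ?_) (fun a => ?_)
  -- The least point: the first index whose fibre is nonempty, then the minimum of that compact
  -- fibre.
  · obtain ⟨i, ⟨x, hx⟩, hmin⟩ := WellFounded.has_min (measure n).wf {i | ∃ x, h i x = y} (hsurj y)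
    obtain ⟨z, hz, hz'⟩ := (hfib i y).isCompact.exists_isMinOn ⟨x, hx⟩
      (continuous_subtype_val (p := (· ∈ cantorSet))).continuousOn
    refine ⟨(i, z), hz, ?_⟩
    rintro ⟨j, w⟩ hw
    rcases (not_lt.1 (hmin j ⟨w, hw⟩) : n i ≤ n j).lt_or_eq with h1 | h1
    · exact (hlt _ _ _ _ h1).le
    · obtain rfl := hn h1
      have : (z : ℝ) ≤ w := hz' hw
      simpa [e] using this
  · have hU : (fun p : ι × cantorSet => h p.1 p.2) '' {p | e p ≤ a} =
        ⋃ i, h i '' {x | e (i, x) ≤ a} := by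
      ext y; simp
    rw [hU]
    refine MeasurableSet.iUnion fun i => himg i _ ?_
    exact isClosed_le (by fun_prop) continuous_const

/-! ### Locally Hausdorff spaces -/

theorem LocallyHausdorff.t1Space {X : Type*} [TopologicalSpace X] (h : LocallyHausdorff X) :
    T1Space X := by
  refine t1Space_iff_exists_open.2 fun x y hxy => ?_
  obtain ⟨V, hV, hx, hT⟩ := h x
  by_cases hy : y ∈ V
  · obtain ⟨A, B, hA, -, hxA, hyB, hAB⟩ := t2_separation (fun e => hxy (congrArg Subtype.val e) :
      (⟨x, hx⟩ : V) ≠ ⟨y, hy⟩)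
    refine ⟨Subtype.val '' A, hV.isOpenMap_subtype_val A hA, ⟨_, hxA, rfl⟩, ?_⟩
    rintro ⟨z, hz, rfl⟩
    exact disjoint_left.1 hAB hz hyB
  · exact ⟨V, hV, hx, hy⟩

theorem LocallyHausdorff.of_injective {X Y : Type*} [TopologicalSpace X] [TopologicalSpace Y]
    (h : LocallyHausdorff Y) {f : X → Y} (hf : Continuous f) (hinj : Injective f) :
    LocallyHausdorff X := by
  intro x
  obtain ⟨V, hV, hx, hT⟩ := h (f x)
  exact ⟨f ⁻¹' V, hV.preimage hf, hx,
    T2Space.of_injective_continuous (f := fun z : f ⁻¹' V => (⟨f z, z.2⟩ : V))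
      (fun a b hab => Subtype.ext (hinj (congrArg Subtype.val hab))) (by fun_prop)⟩

/-- Without a Hausdorff target the kernel relation of a continuous map may fail to be closed;
confining the values to one Hausdorff subspace restores this. -/
theorem isClosed_eq_of_range_subset {K X : Type*} [TopologicalSpace K] [TopologicalSpace X]
    {f : K → X} (hf : Continuous f) {V : Set X} [T2Space V] (hV : ∀ x, f x ∈ V) :
    IsClosed {p : K × K | f p.1 = f p.2} := by
  have hg : Continuous fun x => (⟨f x, hV x⟩ : V) := hf.subtype_mk _
  convert isClosed_eq (hg.comp continuous_fst) (hg.comp continuous_snd) using 1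
  ext p
  simp

/-- A compact set need not be closed in `X`, but it is closed in the Hausdorff subspace `V`, and `V`
is open. -/
theorem measurableSet_of_isCompact_subset {X : Type*} [TopologicalSpace X] [MeasurableSpace X]
    [BorelSpace X] {A V : Set X} (hA : IsCompact A) (hV : IsOpen V) [T2Space V] (hAV : A ⊆ V) :
    MeasurableSet A := by
  have h : Subtype.val '' (Subtype.val ⁻¹' A : Set V) = A := by
    rw [Subtype.image_preimage_coe, inter_eq_right.2 hAV]
  have hc : IsCompact (Subtype.val ⁻¹' A : Set V) := by rwa [Subtype.isCompact_iff, h]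
  rw [← h]
  exact (MeasurableEmbedding.subtype_coe hV.measurableSet).measurableSet_image.2
    hc.isClosed.measurableSet

/-- A second countable, locally Hausdorff, locally compact space is covered by countably many
continuous images of the Cantor set, each of them mapped into an open Hausdorff set by a given
continuous map into a locally Hausdorff space. -/
theorem exists_cantorSet_cover {X U : Type*} [TopologicalSpace X] [SecondCountableTopology X]
    [LocallyCompactSpace X] [TopologicalSpace U] (hX : LocallyHausdorff X)
    (hU : LocallyHausdorff U) {s : X → U} (hs : Continuous s) :
    ∃ t : Set X, t.Countable ∧ ∃ f : t → cantorSet → X, (∀ i, Continuous (f i)) ∧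
      (∀ x, ∃ i z, f i z = x) ∧ ∀ i, ∃ V : Set U, IsOpen V ∧ T2Space V ∧ ∀ z, s (f i z) ∈ V := by
  have key : ∀ x : X, ∃ f : cantorSet → X, Continuous f ∧ range f ∈ 𝓝 x ∧
      ∃ V : Set U, IsOpen V ∧ T2Space V ∧ ∀ z, s (f z) ∈ V := by
    intro x
    obtain ⟨V, hV, hx, hT⟩ := hX x
    obtain ⟨V', hV', hx', hT'⟩ := hU (s x)
    obtain ⟨K, hK, hxK, hKV⟩ := exists_compact_subset (hV.inter (hV'.preimage hs)) ⟨hx, hx'⟩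
    have : CompactSpace K := isCompact_iff_compactSpace.1 hK
    have : T2Space K := T2Space.of_injective_continuous
      (f := inclusion fun z hz => (hKV hz).1) (inclusion_injective _) (continuous_inclusion _)
    have : Nonempty K := ⟨⟨x, interior_subset hxK⟩⟩
    -- `K` is compact, Hausdorff and second countable, hence metrizable, and nonempty compact metric
    -- spaces are continuous images of the Cantor space.
    let : MetricSpace K := TopologicalSpace.metrizableSpaceMetric K
    obtain ⟨f, hf, hfs⟩ := exists_nat_bool_continuous_surjective_of_compact K
    refine ⟨fun z => f (cantorSetHomeomorphNatToBool z),
      continuous_subtype_val.comp (hf.comp cantorSetHomeomorphNatToBool.continuous), ?_,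
      V', hV', hT', fun z => (hKV (f _).2).2⟩
    refine Filter.mem_of_superset (mem_interior_iff_mem_nhds.1 hxK) fun z hz => ?_
    obtain ⟨w, hw⟩ := hfs ⟨z, hz⟩
    exact ⟨cantorSetHomeomorphNatToBool.symm w, by simp [hw]⟩
  choose f hf hfn hfV using key
  obtain ⟨t, ht, htU⟩ := TopologicalSpace.countable_cover_nhds hfn
  refine ⟨t, ht, fun i => f i, fun i => hf i, fun x => ?_, fun i => hfV i⟩
  have hx := htU.symm ▸ mem_univ x
  simp only [mem_iUnion, mem_range] at hx
  obtain ⟨y, hy, z, hz⟩ := hx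
  exact ⟨⟨y, hy⟩, z, hz⟩

/-- In a Hausdorff space, a union of countably many continuous images of a compact metrizable space
is countably separated. -/
theorem countablySeparated_of_iUnion_range {ι K Q : Type*} [Countable ι] [TopologicalSpace K]
    [CompactSpace K] [T2Space K] [SecondCountableTopology K] [TopologicalSpace Q] [T2Space Q]
    [MeasurableSpace Q] [OpensMeasurableSpace Q] {f : ι → K → Q} (hf : ∀ i, Continuous (f i))
    {S : Set Q} (hS : ∀ q ∈ S, ∃ i x, f i x = q) : CountablySeparated S := by
  rw [CountablySeparated.subtype_iff]
  -- The separating sets are the images of closures of basic open sets: they are compact, hence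
  -- closed in `Q`. If `q = f i x` differs from `q'`, regularity of `K` gives a basic neighbourhood
  -- of `x` whose closure has image avoiding `q'`.
  refine ⟨⟨range fun p : ι × TopologicalSpace.countableBasis K => f p.1 '' closure p.2,
    ?_, ?_, ?_⟩⟩
  · have := (TopologicalSpace.countable_countableBasis K).to_subtype
    exact countable_range _
  · rintro _ ⟨p, rfl⟩
    exact (isClosed_closure.isCompact.image (hf p.1)).isClosed.measurableSet
  · intro q hq q' _ h
    by_contra hne
    obtain ⟨i, x, rfl⟩ := hS q hq
    have hx : {z | f i z ≠ q'} ∈ 𝓝 x :=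
      (isOpen_ne.preimage (hf i)).mem_nhds hne
    obtain ⟨B, hB, hxB, hBs⟩ :=
      (TopologicalSpace.isBasis_countableBasis K).exists_closure_subset hx
    obtain ⟨z, hz, hz'⟩ := (h _ ⟨(i, ⟨B, hB⟩), rfl⟩).1 ⟨x, subset_closure hxB, rfl⟩
    exact hBs hz hz'

/-! ### Analytic Borel spaces -/

/-- Converse to `isAnalyticBorel_of_surjective`: together they characterise analytic spaces as
countably separated Borel images of standard ones, from which the closure properties below follow.
-/
theorem IsAnalyticBorel.exists_surjective {X : Type*} [mX : MeasurableSpace X]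
    (h : IsAnalyticBorel X) : ∃ (W : Type) (_ : MeasurableSpace W) (_ : StandardBorelSpace W)
      (φ : W → X), Measurable φ ∧ Surjective φ := by
  obtain ⟨P, _, _, f, hinj, han, rfl⟩ := h
  obtain ⟨W, _, _, g, hg, hgf⟩ := analyticSet_iff_exists_polishSpace_range.1 han
  have hex : ∀ w, ∃ x, f x = g w := fun w => by
    have := mem_range_self (f := g) w
    rwa [hgf] at this
  choose φ hφ using hex
  borelize W P
  refine ⟨W, inferInstance, inferInstance, φ, ?_, fun x => ?_⟩
  · rw [measurable_comap_iff]
    convert hg.measurable using 1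
    exact funext hφ
  · obtain ⟨w, hw⟩ : f x ∈ range g := hgf ▸ mem_range_self x
    exact ⟨w, hinj ((hφ w).trans hw)⟩

theorem IsAnalyticBorel.countablySeparated {X : Type*} [mX : MeasurableSpace X]
    (h : IsAnalyticBorel X) : CountablySeparated X := by
  obtain ⟨P, _, _, f, hinj, -, rfl⟩ := h
  borelize P
  exact @countablySeparated_of_injective X P (.comap f _) _ _ f (comap_measurable f) hinj

theorem IsAnalyticBorel.of_surjective {X Z : Type*} [MeasurableSpace X] [MeasurableSpace Z]
    (h : IsAnalyticBorel X) [CountablySeparated Z] {f : X → Z} (hf : Measurable f)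
    (hsurj : Surjective f) : IsAnalyticBorel Z := by
  obtain ⟨W, _, _, φ, hφ, hφs⟩ := h.exists_surjective
  exact isAnalyticBorel_of_surjective (hf.comp hφ) (hsurj.comp hφs)

theorem IsAnalyticBorel.prod {X Y : Type*} [MeasurableSpace X] [MeasurableSpace Y]
    (hX : IsAnalyticBorel X) (hY : IsAnalyticBorel Y) : IsAnalyticBorel (X × Y) := by
  obtain ⟨W, _, _, φ, hφ, hφs⟩ := hX.exists_surjective
  obtain ⟨W', _, _, ψ, hψ, hψs⟩ := hY.exists_surjective
  have := hX.countablySeparated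
  have := hY.countablySeparated
  have := countablySeparated_prod (X := X) (Y := Y)
  exact isAnalyticBorel_of_surjective (hφ.prodMap hψ) (hφs.prodMap hψs)

theorem IsAnalyticBorel.subtype {X : Type*} [MeasurableSpace X] (hX : IsAnalyticBorel X)
    {p : X → Prop} (hp : MeasurableSet {x | p x}) : IsAnalyticBorel {x // p x} := by
  obtain ⟨W, _, _, φ, hφ, hφs⟩ := hX.exists_surjective
  have := hX.countablySeparated
  have : CountablySeparated {x // p x} :=
    countablySeparated_of_injective measurable_subtype_coe Subtype.val_injective
  have : StandardBorelSpace (φ ⁻¹' {x | p x}) := (hφ hp).standardBorel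
  refine isAnalyticBorel_of_surjective (f := fun w : φ ⁻¹' {x | p x} => (⟨φ w, w.2⟩ : {x // p x}))
    ((hφ.comp measurable_subtype_coe).subtype_mk) ?_
  rintro ⟨x, hx⟩
  obtain ⟨w, rfl⟩ := hφs x
  exact ⟨⟨w, hx⟩, rfl⟩

/-! ### Proper actions -/

/-- An action is proper if it admits an equivariant Borel map to the groupoid that is compatible
with the moment map. -/
theorem LeftAction.isProper_of_equivariant {G U X : Type*} {𝒢 : AlgGroupoid G U}
    [MeasurableSpace G] [MeasurableSpace X] [MeasurableSingletonClass G]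
    [MeasurableSingletonClass X] (A : LeftAction 𝒢 X) {F : X → G} (hF : Measurable F)
    (hr : ∀ x, A.moment x = 𝒢.r (F x))
    (hact : ∀ g x (e : 𝒢.s g = A.moment x), F (A.act g x e) = 𝒢.mul g (F x) (e.trans (hr x))) :
    A.IsProper where
  surjective x := ⟨⟨(x, F x), hr x⟩, rfl⟩
  measurable := measurable_fst.comp measurable_subtype_coe
  equivariant := ⟨fun _ => rfl, fun _ _ _ => rfl⟩
  exists_system := by
    have hΦ : Measurable fun x : X => (⟨(x, F x), hr x⟩ : A.Fibred) :=
      (measurable_id.prodMk hF).subtype_mk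
    -- Dirac masses along the section `x ↦ (x, F x)` of the projection; equivariance of `F` says
    -- that the diagonal action preserves this section.
    refine ⟨fun x => Measure.dirac ⟨(x, F x), hr x⟩, ⟨fun x => inferInstance, fun x => ?_,
      fun f hf => ?_⟩, fun g x e E _ => ?_⟩
    · simp [Measure.dirac_apply]
    · simp only [lintegral_dirac' _ hf]
      exact hf.comp hΦ
    · have heq : (⟨(A.act g x e, F (A.act g x e)), hr _⟩ : A.Fibred) =
          A.diag.act g ⟨(x, F x), hr x⟩ e := Subtype.ext (Prod.ext rfl (hact g x e))
      rw [Measure.dirac_apply, Measure.dirac_apply, heq]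
      refine indicator_eq_indicator ?_ rfl
      exact ⟨fun h => ⟨e, h⟩, fun ⟨_, h⟩ => h⟩

/-! ### Opposite actions and symmetry of Borel equivalence -/

/-- The right action `x • g = g⁻¹ • x` that corresponds to a left action. -/
def LeftAction.toRight {G U X : Type*} {𝒢 : AlgGroupoid G U} (A : LeftAction 𝒢 X) :
    RightAction 𝒢 X where
  moment := A.moment
  act x g e := A.act (𝒢.inv g) x ((𝒢.s_inv g).trans e.symm)
  moment_act x g e := (A.moment_act _ _ _).trans (𝒢.r_inv g)
  act_unit x := by
    have h : ∀ (g : G) (_ : g = 𝒢.unit (A.moment x)) (e : 𝒢.s g = A.moment x),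
        A.act g x e = x := by
      intro g hg e; subst hg; exact A.unit_act x
    exact h _ (𝒢.inv_unit _) _
  act_mul x g h e₁ e₂ := by
    have e₀ : 𝒢.s (𝒢.inv h) = 𝒢.r (𝒢.inv g) := (𝒢.s_inv h).trans (e₂.symm.trans (𝒢.r_inv g).symm)
    have h' : ∀ (k : G) (_ : k = 𝒢.mul (𝒢.inv h) (𝒢.inv g) e₀) (e : 𝒢.s k = A.moment x),
        A.act k x e = A.act (𝒢.inv h) (A.act (𝒢.inv g) x ((𝒢.s_inv g).trans e₁.symm))
          (e₀.trans (A.moment_act _ _ _).symm) := by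
      intro k hk e; subst hk; exact A.mul_act _ _ x _ _
    exact h' _ (𝒢.inv_mul_rev g h e₂) _

theorem LeftAction.toLeft_toRight {G U X : Type*} {𝒢 : AlgGroupoid G U} (A : LeftAction 𝒢 X) :
    A.toRight.toLeft = A := by
  have h : ∀ (g k : G) (_ : k = g) (x : X) (e : 𝒢.s k = A.moment x) (e' : 𝒢.s g = A.moment x),
      A.act k x e = A.act g x e' := by
    rintro g _ rfl x e e'; rfl
  have hact : ∀ g x (e : 𝒢.s g = A.moment x), A.toRight.toLeft.act g x e = A.act g x e :=
    fun g x e => h _ _ (𝒢.inv_inv g) x _ _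
  revert hact
  cases A
  intro hact
  simp only [LeftAction.toRight, RightAction.toLeft] at hact ⊢
  congr 1
  funext g x e
  exact hact g x e

theorem RightAction.IsFree.toLeft {G U X : Type*} {𝒢 : AlgGroupoid G U} {R : RightAction 𝒢 X}
    (h : R.IsFree) : R.toLeft.IsFree := fun g x e hg => by
  have h1 := congrArg 𝒢.inv (h x (𝒢.inv g) _ hg)
  rwa [𝒢.inv_inv, 𝒢.inv_unit] at h1

theorem LeftAction.IsFree.toRight {G U X : Type*} {𝒢 : AlgGroupoid G U} {A : LeftAction 𝒢 X}
    (h : A.IsFree) : A.toRight.IsFree := fun x g e hg => by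
  have h1 := congrArg 𝒢.inv (h (𝒢.inv g) x _ hg)
  rwa [𝒢.inv_inv, 𝒢.inv_unit] at h1

theorem RightAction.IsBorel.toLeft {G U X : Type*} {𝒢 : AlgGroupoid G U} [MeasurableSpace G]
    [MeasurableSpace U] [MeasurableSpace X] {R : RightAction 𝒢 X} (h : R.IsBorel)
    (hinv : Measurable 𝒢.inv) : R.toLeft.IsBorel where
  analytic := h.analytic
  measurable_moment := h.measurable_moment
  measurable_act := h.measurable_act.comp
    (f := fun p : {p : G × X // 𝒢.s p.1 = R.moment p.2} =>
      (⟨(p.1.2, 𝒢.inv p.1.1), p.2.symm.trans (𝒢.r_inv _).symm⟩ :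
        {p : X × G // R.moment p.1 = 𝒢.r p.2}))
    (measurable_subtype_coe.snd.prodMk (hinv.comp measurable_subtype_coe.fst)).subtype_mk

theorem LeftAction.IsBorel.toRight {G U X : Type*} {𝒢 : AlgGroupoid G U} [MeasurableSpace G]
    [MeasurableSpace U] [MeasurableSpace X] {A : LeftAction 𝒢 X} (h : A.IsBorel)
    (hinv : Measurable 𝒢.inv) : A.toRight.IsBorel where
  analytic := h.analytic
  measurable_moment := h.measurable_moment
  measurable_act := h.measurable_act.comp
    (f := fun p : {p : X × G // A.moment p.1 = 𝒢.r p.2} =>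
      (⟨(𝒢.inv p.1.2, p.1.1), (𝒢.s_inv _).trans p.2.symm⟩ :
        {p : G × X // 𝒢.s p.1 = A.moment p.2}))
    ((hinv.comp measurable_subtype_coe.snd).prodMk measurable_subtype_coe.fst).subtype_mk

/-- Passing to inverses exchanges the sides of the two actions. This is needed because `G` carries
the kernel on its left, while the final claim lists the skew product first. -/
theorem IsBorelEquivalence.symm {G U H V Z : Type*} [MeasurableSpace G] [MeasurableSpace U]
    [MeasurableSpace H] [MeasurableSpace V] [MeasurableSpace Z]
    {𝒢 : AlgGroupoid G U} {ℋ : AlgGroupoid H V} {L : LeftAction 𝒢 Z} {R : RightAction ℋ Z}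
    (h : IsBorelEquivalence L R) (h𝒢 : Measurable 𝒢.inv) (hℋ : Measurable ℋ.inv) :
    IsBorelEquivalence R.toLeft L.toRight where
  left_borel := h.right_borel.toLeft hℋ
  left_free := h.right_free.toLeft
  left_proper := h.right_proper
  right_borel := h.left_borel.toRight h𝒢
  right_free := h.left_free.toRight
  right_proper := by
    rw [RightAction.IsProper, L.toLeft_toRight]
    exact h.left_proper
  left_moment_act z g e := h.right_moment_act _ z _
  right_moment_act g z e := h.left_moment_act z _ _
  comm g z k e₁ e₂ := (h.comm _ z _ _ _).symm
  quotient_right := by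
    rw [RightAction.orbitRel, L.toLeft_toRight]
    exact h.quotient_left
  quotient_left := h.quotient_right

/-- A Borel map on `X` with a Borel section, whose fibres are the classes of an equivalence
relation, induces a Borel isomorphism of the quotient. -/
theorem exists_quotient_measurableEquiv {X Y : Type*} [MeasurableSpace X] [MeasurableSpace Y]
    (S : Setoid X) {f : X → Y} (hf : Measurable f) {σ : Y → X} (hσ : Measurable σ)
    (hfσ : ∀ y, f (σ y) = y) (hS : ∀ x x', S x x' ↔ f x = f x') :
    ∃ φ : Quotient S ≃ᵐ Y, ∀ x, φ (Quotient.mk S x) = f x := by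
  refine ⟨⟨⟨Quotient.lift f fun x x' h => (hS x x').1 h, fun y => Quotient.mk S (σ y), ?_, hfσ⟩,
    ?_, measurable_quotient_mk''.comp hσ⟩, fun x => rfl⟩
  · rintro ⟨x⟩
    exact Quotient.sound ((hS _ _).2 (hfσ _))
  · exact measurable_from_quotient.2 hf

/-! ### The kernel and the skew product -/

namespace Cocycle

variable {G U Q : Type*} {𝒢 : AlgGroupoid G U} [Group Q] (c : Cocycle 𝒢 Q)

theorem kerAction_isFree : c.kerAction.IsFree := fun n γ e h =>
  Subtype.ext <| by
    have e' : 𝒢.s n.1 = 𝒢.r γ := e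
    replace h : 𝒢.mul n.1 γ e' = γ := h
    have h1 := 𝒢.mul_assoc n.1 γ (𝒢.inv γ) e' (𝒢.r_inv γ).symm
    rw [𝒢.mul_congr h rfl, 𝒢.mul_congr rfl (𝒢.mul_inv γ), 𝒢.mul_unit', 𝒢.mul_inv] at h1
    exact h1.symm

theorem skewYAction_isFree : c.skewYAction.IsFree := fun η p e h => by
  have e' : 𝒢.s η = 𝒢.r p.1.1.2.1 := congrArg (fun y : c.Y => y.1.1) e
  have ec : c η = p.1.1.1 := congrArg (fun y : c.Y => y.1.2) e
  have h1 : p.1.1.2.1 = 𝒢.unit (𝒢.s η) := by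
    replace h : 𝒢.mul η p.1.1.2.1 e' = η := h
    have h1 := 𝒢.mul_assoc (𝒢.inv η) η p.1.1.2.1 (𝒢.s_inv η) e'
    rw [𝒢.mul_congr rfl h, 𝒢.mul_congr (𝒢.inv_mul η) rfl, 𝒢.unit_mul', 𝒢.inv_mul] at h1
    exact h1
  refine Subtype.ext (Subtype.ext (Prod.ext ec.symm (Prod.ext h1 ?_)))
  have h2 := p.1.2
  rw [h1, c.map_unit, mul_one] at h2
  exact h2.trans ec.symm

theorem kerAction_orbitRel (x y : G) : c.kerAction.orbitRel x y ↔ c.sTilde x = c.sTilde y := by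
  constructor
  · rintro ⟨n, e, rfl⟩
    refine Prod.ext (𝒢.s_mul _ _ _).symm ((c.map_mul _ _ _).trans ?_).symm
    rw [n.2, one_mul]
    rfl
  · intro h
    have hs : 𝒢.s x = 𝒢.s y := congrArg Prod.fst h
    have hc : c x = c y := congrArg Prod.snd h
    have e : 𝒢.s y = 𝒢.r (𝒢.inv x) := hs.symm.trans (𝒢.r_inv x).symm
    -- The element `y x⁻¹` carries `x` to `y`, and lies in the kernel because `c x = c y`.
    refine ⟨⟨𝒢.mul y (𝒢.inv x) e, (c.map_mul _ _ e).trans (by rw [c.map_inv, hc, mul_inv_cancel])⟩,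
      (𝒢.s_mul _ _ _).trans (𝒢.s_inv x), ?_⟩
    refine (𝒢.mul_assoc y (𝒢.inv x) x e (𝒢.s_inv x)).trans ?_
    rw [𝒢.mul_congr rfl (𝒢.inv_mul x), 𝒢.mul_unit']

theorem mem_Y_of_s_eq {η γ : G} (e : 𝒢.s η = 𝒢.r γ) : (𝒢.r γ, c η) ∈ c.Y :=
  ⟨η, Prod.ext e rfl⟩

theorem mem_Y_of_mul {η γ : G} (e : 𝒢.s η = 𝒢.r γ) : (𝒢.s γ, c η * c γ) ∈ c.Y :=
  ⟨𝒢.mul η γ e, Prod.ext (𝒢.s_mul _ _ _) (c.map_mul _ _ _)⟩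

/-- The arrow `(c(η), γ, c(ηγ))` of `𝒢(c)|_Y` that is given by a composable pair `(η, γ)`. -/
def skewYArrow (p : 𝒢.Composable) : {p : c.SkewArrow // c.skew.r p ∈ c.Y ∧ c.skew.s p ∈ c.Y} :=
  ⟨⟨(c p.1.1, p.1.2, c p.1.1 * c p.1.2), rfl⟩, c.mem_Y_of_s_eq p.2, c.mem_Y_of_mul p.2⟩

theorem skewYArrow_surjective : Surjective c.skewYArrow := by
  rintro ⟨⟨⟨a, γ, b⟩, hb⟩, ⟨η, hη⟩, h2⟩
  have h1 : 𝒢.s η = 𝒢.r γ := congrArg Prod.fst hη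
  obtain rfl : c η = a := congrArg Prod.snd hη
  obtain rfl : b = c η * c γ := hb
  exact ⟨⟨(η, γ), h1⟩, rfl⟩

theorem skewYAction_orbitRel (x y : G) : c.skewYAction.orbitRel x y ↔ 𝒢.r x = 𝒢.r y := by
  constructor
  · rintro ⟨p, e, rfl⟩
    exact (𝒢.r_mul _ _ _).symm
  · intro h
    have e : 𝒢.s y = 𝒢.r (𝒢.inv y) := (𝒢.r_inv y).symm
    have e' : 𝒢.s (𝒢.inv y) = 𝒢.r x := (𝒢.s_inv y).trans h.symm
    have e₂ : 𝒢.s y = 𝒢.r (𝒢.mul (𝒢.inv y) x e') := e.trans (𝒢.r_mul _ _ _).symm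
    -- The arrow `(c y, y⁻¹ x, c x)` carries `y` to `x` on the right; its inverse appears because
    -- orbits are defined through the corresponding left action.
    refine c.skewYAction.orbitRel.symm ⟨c.skewY.inv (c.skewYArrow ⟨(y, 𝒢.mul (𝒢.inv y) x e'), e₂⟩), ?_, ?_⟩
    · rw [c.skewY.s_inv]
      exact Subtype.ext (Prod.ext e₂.symm rfl)
    · refine (𝒢.mul_congr (h' := 𝒢.mul (𝒢.inv y) x e') rfl (𝒢.inv_inv _) _).trans ?_
      rw [← 𝒢.mul_assoc y (𝒢.inv y) x e e', 𝒢.mul_congr (𝒢.mul_inv y) rfl, 𝒢.unit_mul']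

/-! ### Borel structure of the kernel and of the reduced skew product -/

section Borel

variable [MeasurableSpace G] [MeasurableSpace U] [MeasurableSpace Q]

theorem measurable_sTilde (h𝒢 : IsBorelGroupoid 𝒢) (hc : Measurable c) : Measurable c.sTilde :=
  h𝒢.measurable_s.prodMk hc

omit [MeasurableSpace Q] in
theorem isBorelGroupoid_ker (h𝒢 : IsBorelGroupoid 𝒢) (hc : MeasurableSet {g | c g = 1}) :
    IsBorelGroupoid c.ker where
  analytic := h𝒢.analytic.subtype hc
  analytic_unit := h𝒢.analytic_unit
  measurable_r := h𝒢.measurable_r.comp measurable_subtype_coe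
  measurable_s := h𝒢.measurable_s.comp measurable_subtype_coe
  measurable_unit := h𝒢.measurable_unit.subtype_mk
  measurable_inv := (h𝒢.measurable_inv.comp measurable_subtype_coe).subtype_mk
  measurable_mul := (h𝒢.measurable_mul.comp (f := fun p : c.ker.Composable =>
    (⟨(p.1.1.1, p.1.2.1), p.2⟩ : 𝒢.Composable))
    ((measurable_subtype_coe.comp measurable_subtype_coe.fst).prodMk
      (measurable_subtype_coe.comp measurable_subtype_coe.snd)).subtype_mk).subtype_mk

/-- Reduction to `Y` forces the `Q`-coordinates into `range c`, which gives countable separation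
although `Q` may be large. Arrows and units are then analytic as Borel images of the composable
pairs and of `G`. -/
theorem isBorelGroupoid_skewY (h𝒢 : IsBorelGroupoid 𝒢) (hc : Measurable c)
    [CountablySeparated (range c)] : IsBorelGroupoid c.skewY where
  analytic := by
    have := h𝒢.analytic.countablySeparated
    have := h𝒢.analytic_unit.countablySeparated
    have := measurableEq_of_countablySeparated U
    have := countablySeparated_prod (X := G) (Y := range c)
    have := countablySeparated_prod (X := range c) (Y := G × range c)
    have ha : ∀ p : {p : c.SkewArrow // c.skew.r p ∈ c.Y ∧ c.skew.s p ∈ c.Y},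
        p.1.1.1 ∈ range c := fun p => p.2.1.imp fun _ h => congrArg Prod.snd h
    have hb : ∀ p : {p : c.SkewArrow // c.skew.r p ∈ c.Y ∧ c.skew.s p ∈ c.Y},
        p.1.1.2.2 ∈ range c := fun p => p.2.2.imp fun _ h => congrArg Prod.snd h
    have hm : Measurable fun p : {p : c.SkewArrow // c.skew.r p ∈ c.Y ∧ c.skew.s p ∈ c.Y} =>
      p.1.1 := measurable_subtype_coe.comp measurable_subtype_coe
    have : CountablySeparated {p : c.SkewArrow // c.skew.r p ∈ c.Y ∧ c.skew.s p ∈ c.Y} := by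
      refine countablySeparated_of_injective (Y := range c × G × range c)
        (f := fun p => (⟨_, ha p⟩, p.1.1.2.1, ⟨_, hb p⟩))
        (hm.fst.subtype_mk.prodMk (hm.snd.fst.prodMk hm.snd.snd.subtype_mk)) ?_
      intro p q h
      simp only [Prod.mk.injEq, Subtype.mk.injEq] at h
      exact Subtype.ext (Subtype.ext (Prod.ext h.1 (Prod.ext h.2.1 h.2.2)))
    have hcomp : IsAnalyticBorel 𝒢.Composable := (h𝒢.analytic.prod h𝒢.analytic).subtype
      (measurableSet_eq_fun (h𝒢.measurable_s.comp measurable_fst)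
        (h𝒢.measurable_r.comp measurable_snd))
    refine hcomp.of_surjective (f := c.skewYArrow) ?_ c.skewYArrow_surjective
    -- Multiplication in `Q` is not assumed Borel for the product structure, so the product is read
    -- as `c` of a product in the groupoid.
    have hmul : Measurable fun p : 𝒢.Composable => c p.1.1 * c p.1.2 := by
      convert hc.comp h𝒢.measurable_mul using 1
      exact funext fun p => (c.map_mul _ _ p.2).symm
    exact ((hc.comp measurable_subtype_coe.fst).prodMk
      (measurable_subtype_coe.snd.prodMk hmul)).subtype_mk.subtype_mk
  analytic_unit := by
    have := h𝒢.analytic_unit.countablySeparated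
    have := countablySeparated_prod (X := U) (Y := range c)
    have hY : ∀ y : c.Y, y.1.2 ∈ range c := fun y => y.2.imp fun _ h => congrArg Prod.snd h
    have : CountablySeparated c.Y := by
      refine countablySeparated_of_injective (Y := U × range c) (f := fun y => (y.1.1, ⟨_, hY y⟩))
        (measurable_subtype_coe.fst.prodMk measurable_subtype_coe.snd.subtype_mk) ?_
      intro y z h
      simp only [Prod.mk.injEq, Subtype.mk.injEq] at h
      exact Subtype.ext (Prod.ext h.1 h.2)
    exact h𝒢.analytic.of_surjective (f := rangeFactorization c.sTilde)
      (c.measurable_sTilde h𝒢 hc).subtype_mk rangeFactorization_surjective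
  measurable_r := by
    have hm : Measurable fun p : {p : c.SkewArrow // c.skew.r p ∈ c.Y ∧ c.skew.s p ∈ c.Y} =>
      p.1.1 := measurable_subtype_coe.comp measurable_subtype_coe
    exact ((h𝒢.measurable_r.comp hm.snd.fst).prodMk hm.fst).subtype_mk
  measurable_s := by
    have hm : Measurable fun p : {p : c.SkewArrow // c.skew.r p ∈ c.Y ∧ c.skew.s p ∈ c.Y} =>
      p.1.1 := measurable_subtype_coe.comp measurable_subtype_coe
    exact ((h𝒢.measurable_s.comp hm.snd.fst).prodMk hm.snd.snd).subtype_mk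
  measurable_unit :=
    (measurable_subtype_coe.snd.prodMk ((h𝒢.measurable_unit.comp measurable_subtype_coe.fst).prodMk
      measurable_subtype_coe.snd)).subtype_mk.subtype_mk
  measurable_inv := by
    have hm : Measurable fun p : {p : c.SkewArrow // c.skew.r p ∈ c.Y ∧ c.skew.s p ∈ c.Y} =>
      p.1.1 := measurable_subtype_coe.comp measurable_subtype_coe
    exact (hm.snd.snd.prodMk
      ((h𝒢.measurable_inv.comp hm.snd.fst).prodMk hm.fst)).subtype_mk.subtype_mk
  measurable_mul := by
    have hm : Measurable fun p : {p : c.SkewArrow // c.skew.r p ∈ c.Y ∧ c.skew.s p ∈ c.Y} =>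
      p.1.1 := measurable_subtype_coe.comp measurable_subtype_coe
    have h1 : Measurable fun p : c.skewY.Composable => p.1.1.1.1 :=
      hm.comp measurable_subtype_coe.fst
    have h2 : Measurable fun p : c.skewY.Composable => p.1.2.1.1 :=
      hm.comp measurable_subtype_coe.snd
    exact (h1.fst.prodMk ((h𝒢.measurable_mul.comp (f := fun p : c.skewY.Composable =>
      (⟨(p.1.1.1.1.2.1, p.1.2.1.1.2.1), congrArg (fun y : c.Y => y.1.1) p.2⟩ : 𝒢.Composable))
      (h1.snd.fst.prodMk h2.snd.fst).subtype_mk).prodMk h2.snd.snd)).subtype_mk.subtype_mk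

end Borel

end Cocycle

/-! ### Properness and the equivalence, given a Borel section -/

namespace Cocycle

variable {G U Q : Type*} {𝒢 : AlgGroupoid G U} [Group Q] (c : Cocycle 𝒢 Q)
  [MeasurableSpace G] [MeasurableSpace U] [MeasurableSpace Q]

/-- With `τ γ` the chosen representative of the orbit of `γ`, the map `γ ↦ γ (τ γ)⁻¹` takes values
in the kernel, as `c (τ γ) = c γ`, and is equivariant, as `τ` is constant on orbits. -/
theorem isProper_kerAction (h𝒢 : IsBorelGroupoid 𝒢) (hc : Measurable c) {σ : c.Y → G}
    (hσ : Measurable σ) (hσs : ∀ y, c.sTilde (σ y) = y) : c.kerAction.IsProper := by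
  have := h𝒢.analytic.countablySeparated
  have := measurableSingletonClass_of_countablySeparated (α := G)
  have := Subtype.instMeasurableSingletonClass (α := G) (p := fun g => c g = 1)
  let τ : G → G := fun γ => σ ⟨c.sTilde γ, mem_range_self γ⟩
  have hτ : Measurable τ := hσ.comp (c.measurable_sTilde h𝒢 hc).subtype_mk
  have hτs : ∀ γ, 𝒢.s (τ γ) = 𝒢.s γ := fun γ => congrArg Prod.fst (hσs _)
  have hτc : ∀ γ, c (τ γ) = c γ := fun γ => congrArg Prod.snd (hσs _)
  have hcomp : ∀ γ, 𝒢.s γ = 𝒢.r (𝒢.inv (τ γ)) := fun γ => (hτs γ).symm.trans (𝒢.r_inv _).symm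
  refine c.kerAction.isProper_of_equivariant
    (F := fun γ => ⟨𝒢.mul γ (𝒢.inv (τ γ)) (hcomp γ),
      (c.map_mul _ _ _).trans (by rw [c.map_inv, hτc, mul_inv_cancel])⟩) ?_ ?_ ?_
  · exact (h𝒢.measurable_mul.comp (f := fun γ => (⟨(γ, 𝒢.inv (τ γ)), hcomp γ⟩ : 𝒢.Composable))
      (measurable_id.prodMk (h𝒢.measurable_inv.comp hτ)).subtype_mk).subtype_mk
  · exact fun γ => (𝒢.r_mul _ _ _).symm
  · intro n γ e
    have hs : c.sTilde (c.kerAction.act n γ e) = c.sTilde γ :=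
      ((c.kerAction_orbitRel _ _).1 ⟨n, e, rfl⟩).symm
    have hτ' : τ (c.kerAction.act n γ e) = τ γ := congrArg σ (Subtype.ext hs)
    exact Subtype.ext ((𝒢.mul_congr rfl (congrArg 𝒢.inv hτ') _).trans
      (𝒢.mul_assoc n.1 γ (𝒢.inv (τ γ)) e (hcomp γ)))

/-- Here the units represent the orbits: the arrow `(c η, η⁻¹, 1)` carries `η` to the unit at `r η`,
so no section `σ` is required. -/
theorem isProper_skewYAction (h𝒢 : IsBorelGroupoid 𝒢) (hc : Measurable c)
    (hY : IsBorelGroupoid c.skewY) : c.skewYAction.IsProper := by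
  have := h𝒢.analytic.countablySeparated
  have := measurableSingletonClass_of_countablySeparated (α := G)
  have := hY.analytic.countablySeparated
  have := measurableSingletonClass_of_countablySeparated
    (α := {p : c.SkewArrow // c.skew.r p ∈ c.Y ∧ c.skew.s p ∈ c.Y})
  refine c.skewYAction.toLeft.isProper_of_equivariant
    (F := fun η => ⟨⟨(c η, 𝒢.inv η, 1), by rw [c.map_inv, mul_inv_cancel]⟩,
      ⟨η, Prod.ext (𝒢.r_inv η).symm rfl⟩,
      ⟨𝒢.unit (𝒢.r η), Prod.ext ((𝒢.s_unit _).trans (𝒢.s_inv η).symm) (c.map_unit _)⟩⟩) ?_ ?_ ?_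
  · exact (hc.prodMk (h𝒢.measurable_inv.prodMk measurable_const)).subtype_mk.subtype_mk
  · exact fun η => Subtype.ext (Prod.ext (𝒢.r_inv η).symm rfl)
  · rintro ⟨⟨⟨a, γ, b⟩, hb⟩, hp⟩ η e
    have e' : 𝒢.s γ = 𝒢.s η := congrArg (fun y : c.Y => y.1.1) e
    have eb : b = c η := congrArg (fun y : c.Y => y.1.2) e
    have e₀ : 𝒢.s η = 𝒢.r (𝒢.inv γ) := e'.symm.trans (𝒢.r_inv γ).symm
    refine Subtype.ext (Subtype.ext (Prod.ext ?_ (Prod.ext ?_ rfl)))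
    · change c (𝒢.mul η (𝒢.inv γ) e₀) = a
      rw [c.map_mul, c.map_inv, ← eb, show b = a * c γ from hb, mul_inv_cancel_right]
    · refine (𝒢.inv_mul_rev η (𝒢.inv γ) e₀).trans ?_
      exact 𝒢.mul_congr (𝒢.inv_inv γ) rfl _

/-- If `γ ↦ (s(γ), c(γ))` has a Borel section, then `G` is a Borel equivalence between the kernel
of `c` and the reduction of the skew product to the range of this map. -/
theorem isBorelEquivalence (h𝒢 : IsBorelGroupoid 𝒢) (hc : Measurable c)
    (hY : IsBorelGroupoid c.skewY) {σ : c.Y → G} (hσ : Measurable σ)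
    (hσs : ∀ y, c.sTilde (σ y) = y) : IsBorelEquivalence c.kerAction c.skewYAction where
  left_borel :=
    { analytic := h𝒢.analytic
      measurable_moment := h𝒢.measurable_r
      measurable_act := h𝒢.measurable_mul.comp
        (f := fun p : {p : {g // c g = 1} × G // c.ker.s p.1 = c.kerAction.moment p.2} =>
          (⟨(p.1.1.1, p.1.2), p.2⟩ : 𝒢.Composable))
        ((measurable_subtype_coe.comp measurable_subtype_coe.fst).prodMk
          measurable_subtype_coe.snd).subtype_mk }
  left_free := c.kerAction_isFree
  left_proper := c.isProper_kerAction h𝒢 hc hσ hσs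
  right_borel :=
    { analytic := h𝒢.analytic
      measurable_moment := (c.measurable_sTilde h𝒢 hc).subtype_mk
      measurable_act := h𝒢.measurable_mul.comp
        (f := fun p : {p : G × {p : c.SkewArrow // c.skew.r p ∈ c.Y ∧ c.skew.s p ∈ c.Y} //
            c.skewYAction.moment p.1 = c.skewY.r p.2} =>
          (⟨(p.1.1, p.1.2.1.1.2.1), congrArg (fun y : c.Y => y.1.1) p.2⟩ : 𝒢.Composable))
        (measurable_subtype_coe.fst.prodMk (measurable_subtype_coe.comp
          (measurable_subtype_coe.comp measurable_subtype_coe.snd)).snd.fst).subtype_mk }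
  right_free := c.skewYAction_isFree
  right_proper := c.isProper_skewYAction h𝒢 hc hY
  left_moment_act _ _ _ := 𝒢.r_mul _ _ _
  right_moment_act n _ e := Subtype.ext ((c.kerAction_orbitRel _ _).1 ⟨n, e, rfl⟩).symm
  comm n γ p e₁ e₂ := 𝒢.mul_assoc n.1 γ p.1.1.2.1 e₁ (congrArg (fun y : c.Y => y.1.1) e₂)
  quotient_right := exists_quotient_measurableEquiv _ h𝒢.measurable_r h𝒢.measurable_unit
    𝒢.r_unit c.skewYAction_orbitRel
  quotient_left := exists_quotient_measurableEquiv _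
    (f := fun γ => (⟨c.sTilde γ, mem_range_self γ⟩ : c.Y)) (c.measurable_sTilde h𝒢 hc).subtype_mk
    hσ (fun y => Subtype.ext (hσs y))
    fun x y => (c.kerAction_orbitRel x y).trans Subtype.mk_eq_mk.symm

end Cocycle

/-! ### Topological groupoids -/

namespace AlgGroupoid.IsTopological

variable {G U : Type*} {𝒢 : AlgGroupoid G U} [TopologicalSpace G] [TopologicalSpace U]

theorem isEmbedding_unit (h : 𝒢.IsTopological) : IsEmbedding 𝒢.unit :=
  Function.LeftInverse.isEmbedding 𝒢.r_unit h.continuous_r h.continuous_unit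

theorem locallyHausdorff_unitSpace (h : 𝒢.IsTopological) (hG : LocallyHausdorff G) :
    LocallyHausdorff U :=
  hG.of_injective h.continuous_unit h.isEmbedding_unit.injective

theorem secondCountableTopology_unitSpace [SecondCountableTopology G] (h : 𝒢.IsTopological) :
    SecondCountableTopology U :=
  h.isEmbedding_unit.secondCountableTopology

/-- A second countable, locally Hausdorff, locally compact groupoid is a Borel groupoid. -/
theorem isBorelGroupoid [SecondCountableTopology G] [LocallyCompactSpace G] [MeasurableSpace G]
    [BorelSpace G] [MeasurableSpace U] [BorelSpace U] (h : 𝒢.IsTopological)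
    (hG : LocallyHausdorff G) : IsBorelGroupoid 𝒢 := by
  -- Second countable T1 spaces have countably separated Borel structures, so analyticity only needs
  -- a Borel surjection from a standard space: the Cantor pieces onto `G`, then `r` onto `U`.
  have hG1 := hG.t1Space
  have hU1 := (h.locallyHausdorff_unitSpace hG).t1Space
  have := h.secondCountableTopology_unitSpace
  have hA : IsAnalyticBorel G := by
    obtain ⟨t, ht, f, hf, hfs, -⟩ := exists_cantorSet_cover hG hG continuous_id
    have := ht.to_subtype
    have : PolishSpace cantorSet := isClosed_cantorSet.polishSpace
    let : MeasurableSpace t := ⊤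
    refine isAnalyticBorel_of_surjective (f := fun p : t × cantorSet => f p.1 p.2)
      (measurable_from_prod_countable_right fun i => (hf i).measurable) fun g => ?_
    obtain ⟨i, z, hz⟩ := hfs g
    exact ⟨(i, z), hz⟩
  exact ⟨hA, hA.of_surjective h.continuous_r.measurable fun u => ⟨_, 𝒢.r_unit u⟩,
    h.continuous_r.measurable, h.continuous_s.measurable, h.continuous_unit.measurable,
    h.continuous_inv.measurable, h.continuous_mul.measurable⟩

end AlgGroupoid.IsTopological

/-- For a continuous cocycle on a second countable, locally Hausdorff, locally compact groupoid,
the range is countably separated and `γ ↦ (s(γ), c(γ))` has a Borel section. -/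
theorem Cocycle.exists_measurable_section {G U Q : Type*}
    [TopologicalSpace G] [SecondCountableTopology G] [LocallyCompactSpace G]
    [MeasurableSpace G] [BorelSpace G] [TopologicalSpace U] [MeasurableSpace U] [BorelSpace U]
    [Group Q] [TopologicalSpace Q] [T2Space Q] [MeasurableSpace Q] [BorelSpace Q]
    {𝒢 : AlgGroupoid G U} (h𝒢 : 𝒢.IsTopological) (hG : LocallyHausdorff G)
    (c : Cocycle 𝒢 Q) (hc : Continuous c) :
    CountablySeparated (range c) ∧
      ∃ σ : c.Y → G, Measurable σ ∧ ∀ y, c.sTilde (σ y) = y := by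
  have hU := h𝒢.locallyHausdorff_unitSpace hG
  have hU1 := hU.t1Space
  have := h𝒢.secondCountableTopology_unitSpace
  have : CompactSpace cantorSet := isCompact_iff_compactSpace.1 isCompact_cantorSet
  have : PolishSpace cantorSet := isClosed_cantorSet.polishSpace
  obtain ⟨t, ht, f, hf, hfs, hfV⟩ := exists_cantorSet_cover hG hU h𝒢.continuous_s
  have := ht.to_subtype
  let : MeasurableSpace t := ⊤
  have hs : ∀ i, Continuous fun x => 𝒢.s (f i x) := fun i => h𝒢.continuous_s.comp (hf i)
  have hcf : ∀ i, Continuous fun x => c (f i x) := fun i => hc.comp (hf i)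
  have hsep : CountablySeparated (range c) :=
    countablySeparated_of_iUnion_range hcf <| by
      rintro _ ⟨g, rfl⟩
      obtain ⟨i, x, rfl⟩ := hfs g
      exact ⟨i, x, rfl⟩
  refine ⟨hsep, ?_⟩
  let h : t → cantorSet → c.Y := fun i x => ⟨c.sTilde (f i x), mem_range_self _⟩
  have hsec : ∃ σ : c.Y → t × cantorSet, Measurable σ ∧ ∀ y, h (σ y).1 (σ y).2 = y := by
    refine exists_measurable_section_cantorSet (fun i y => ?_) (fun i C hC => ?_) (fun y => ?_)
    -- Fibres are closed because points are closed in `U`, which is T1, and in `Q`.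
    · convert (isClosed_singleton (x := y.1.1).preimage (hs i)).inter
        (isClosed_singleton (x := y.1.2).preimage (hcf i)) using 1
      ext x
      exact Subtype.ext_iff.trans Prod.ext_iff
    · obtain ⟨V, hV, hT, hfV⟩ := hfV i
      have hsub : range (fun x => c (f i x)) ⊆ range c := range_subset_iff.2 fun x => ⟨f i x, rfl⟩
      have : CountablySeparated (range fun x => c (f i x)) :=
        countablySeparated_of_injective (measurable_inclusion hsub) (inclusion_injective hsub)
      -- The sources of this piece stay in the Hausdorff open set `V`, which makes their range Borel
      -- and the kernel of the source map closed; for `c` both follow from `Q` being Hausdorff.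
      have hm := measurableSet_image_pair (hs i).measurable (hcf i).measurable
        (measurableSet_of_isCompact_subset (isCompact_range (hs i)) hV (range_subset_iff.2 hfV))
        (isCompact_range (hcf i)).isClosed.measurableSet
        (isClosed_eq_of_range_subset (hs i) hfV)
        (isClosed_eq ((hcf i).comp continuous_fst) ((hcf i).comp continuous_snd)) hC
      convert measurable_subtype_coe hm using 1
      ext y
      simp only [mem_image, mem_preimage, h, Subtype.ext_iff]
      rfl
    · obtain ⟨g, hg⟩ := y.2
      obtain ⟨i, x, rfl⟩ := hfs g
      exact ⟨i, x, Subtype.ext hg⟩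
  obtain ⟨σ, hσ, hσs⟩ := hsec
  refine ⟨fun y => f (σ y).1 (σ y).2, ?_, fun y => congrArg Subtype.val (hσs y)⟩
  exact (measurable_from_prod_countable_right (f := fun p : t × cantorSet => f p.1 p.2)
    fun i => (hf i).measurable).comp hσ

end BorelGpd

theorem proposition4p3 {G : Type u} {U : Type*} {Q : Type*}
    [TopologicalSpace G] [SecondCountableTopology G] [LocallyCompactSpace G]
    [MeasurableSpace G] [BorelSpace G]
    [TopologicalSpace U] [MeasurableSpace U] [BorelSpace U]
    [Group Q] [TopologicalSpace Q] [IsTopologicalGroup Q] [T2Space Q] [LocallyCompactSpace Q]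
    [MeasurableSpace Q] [BorelSpace Q]
    (𝒢 : AlgGroupoid G U) (h𝒢 : 𝒢.IsTopological) (hG : LocallyHausdorff G)
    (c : Cocycle 𝒢 Q) (hc : Continuous c) :
    IsBorelGroupoid c.skewY ∧ IsBorelGroupoid c.ker ∧
      IsBorelEquivalence c.kerAction c.skewYAction ∧
      BorelEquivalent.{u} c.skewY c.ker := by
  have hB := h𝒢.isBorelGroupoid hG
  obtain ⟨_, σ, hσ, hσs⟩ := c.exists_measurable_section h𝒢 hG hc
  have hY := c.isBorelGroupoid_skewY hB hc.measurable
  have hK := c.isBorelGroupoid_ker hB (hc.measurable (measurableSet_singleton 1))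
  have hE := c.isBorelEquivalence hB hc.measurable hY hσ hσs
  exact ⟨hY, hK, hE, G, inferInstance, _, _, hE.symm hK.measurable_inv hY.measurable_inv⟩
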